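/- **Setting.** Equip $\mathbb{C}^{3}$ with the Hermitian form $\langle z,w\rangle = z_1\overline{w_1}+z_2\overline{w_2}-z_3\overline{w_3}$ of signature $(2,1)$. The complex hyperbolic plane $\mathbf{H}^2_{\mathbb{C}}\subset\mathbb{CP}^2$ is the set of lines spanned by a vector $v$ with $\langle v,v\rangle<0$, and $\partial\mathbf{H}^2_{\mathbb{C}}$ is the set of lines spanned by a nonzero $v$ with $\langle v,v\rangle=0$. The group $\mathrm{PU}(2,1)$, the quotient of the unitary group $\mathrm{U}(2,1)$ of the form by its scalar matrices, acts on $\mathbb{CP}^2$. An element $f\in\mathrm{PU}(2,1)$ is *elliptic* if it fixes a point of $\mathbf{H}^2_{\mathbb{C}}$; an elliptic element is *regular* if a matrix representing it has three distinct eigenvalues; $f$ is *real elliptic* if for some $\theta\in\mathbb{R}$ it is conjugate in $\mathrm{PU}(2,1)$ to the class of $\mathrm{diag}(e^{i\theta},e^{-i\theta},1)$. A *Lagrangian plane* is the set of points of $\mathbf{H}^2_{\mathbb{C}}$ that have a lift in a real subspace $W\subset\mathbb{C}^3$ with $\dim_{\mathbb{R}}W=3$ on which the form is real-valued and which contains a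 vector $v$ with $\langle v,v\rangle<0$. The *ideal boundary* of a subset $S\subset\mathbf{H}^2_{\mathbb{C}}$ is $\partial_\infty S=\overline{S}\cap\partial\mathbf{H}^2_{\mathbb{C}}$, the closure being taken in $\mathbb{CP}^2$; an *$\mathbb{R}$-circle* is the ideal boundary of a Lagrangian plane. **Theorem.** Let $f\in\mathrm{PU}(2,1)$ be a regular, real elliptic isometry. Then $f$ has exactly one fixed point $p_f$ in $\mathbf{H}^2_{\mathbb{C}}$. Let $\mathcal{F}$ be the family of Lagrangian planes $L$ such that $p_f\in L$, $f(L)=L$ and the restriction $f|_L$ is not an involution (that is, $f^2|_L\neq\mathrm{id}_L$). Then $\mathcal{F}$ is parameterised by an angle: $\mathcal{F}=\{L_\theta \mid \theta\in\mathbb{R}/2\pi\mathbb{Z}\}$ with $L_\theta\neq L_{\theta'}$ for $\theta\neq\theta'$. The ideal boundaries $\partial_\infty L_\theta$ are pairwise disjoint $\mathbb{R}$-circles, and their union $\mathbb{T}^2_f\subset\partial\mathbf{H}^2_{\mathbb{C}}$ is a torus. More precisely, the parameterisation can be chosen so that there is a topological embedding $\Phi:\mathbb{R}/2\pi\mathbb{Z}\times\mathbb{R}/2\pi\mathbb{Z}\to\mathbb{CP}^2$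 with image $\mathbb{T}^2_f$ and $\Phi(\{\theta\}\times\mathbb{R}/2\pi\mathbb{Z})=\partial_\infty L_\theta$ for every $\theta$. -/

import Mathlib

open scoped LinearAlgebra.Projectivization Matrix MatrixGroups

noncomputable section

namespace ComplexHyperbolic

/-- The ambient vector space `ℂ^{2,1}`. -/
abbrev V : Type := Fin 3 → ℂ

/-- The complex projective plane. -/
abbrev CP2 : Type := ℙ ℂ V

/-- The matrix of the standard Hermitian form of signature `(2,1)` (unit ball model). -/
def formMatrix : Matrix (Fin 3) (Fin 3) ℂ := Matrix.diagonal ![1, 1, -1]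

/-- The Hermitian form `⟨z, w⟩ = w^* H z = z₁ w̄₁ + z₂ w̄₂ - z₃ w̄₃`. -/
def herm (z w : V) : ℂ := star w ⬝ᵥ (formMatrix *ᵥ z)

/-- The complex projective plane carries the quotient topology. -/
instance : TopologicalSpace CP2 :=
  TopologicalSpace.coinduced (Projectivization.mk' ℂ) inferInstance

/-- The complex hyperbolic plane: the projectivised negative cone. -/
def hyperbolicPlane : Set CP2 :=
  {x | ∃ (v : V) (hv : v ≠ 0), x = Projectivization.mk ℂ v hv ∧ (herm v v).re < 0}

/-- The boundary of the complex hyperbolic plane: the projectivised null cone. -/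
def boundary : Set CP2 :=
  {x | ∃ (v : V) (hv : v ≠ 0), x = Projectivization.mk ℂ v hv ∧ herm v v = 0}

/-- The unitary group `U(2,1)` of the Hermitian form. -/
def U21 : Subgroup (GL (Fin 3) ℂ) where
  carrier := {A | (A : Matrix (Fin 3) (Fin 3) ℂ)ᴴ * formMatrix * A = formMatrix}
  one_mem' := by simp
  mul_mem' := by
    intro A B hA hB
    simp only [Set.mem_ofPred_eq, Units.val_mul, Matrix.conjTranspose_mul] at *
    calc _ = (B : Matrix (Fin 3) (Fin 3) ℂ)ᴴ *
          ((A : Matrix (Fin 3) (Fin 3) ℂ)ᴴ * formMatrix * A) * B := by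
            simp only [Matrix.mul_assoc]
      _ = _ := by rw [hA, hB]
  inv_mem' := by
    intro A hA
    simp only [Set.mem_ofPred_eq] at *
    have h1 : (A : Matrix (Fin 3) (Fin 3) ℂ) * (A⁻¹ : GL (Fin 3) ℂ) = 1 := by
      rw [← Units.val_mul]; simp
    have h2 : ((A⁻¹ : GL (Fin 3) ℂ) : Matrix (Fin 3) (Fin 3) ℂ)ᴴ *
        (A : Matrix (Fin 3) (Fin 3) ℂ)ᴴ = 1 := by
      rw [← Matrix.conjTranspose_mul, h1, Matrix.conjTranspose_one]
    calc _ = ((A⁻¹ : GL (Fin 3) ℂ) : Matrix (Fin 3) (Fin 3) ℂ)ᴴ *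
          ((A : Matrix (Fin 3) (Fin 3) ℂ)ᴴ * formMatrix * A) *
            ((A⁻¹ : GL (Fin 3) ℂ) : Matrix (Fin 3) (Fin 3) ℂ) := by rw [hA]
      _ = (((A⁻¹ : GL (Fin 3) ℂ) : Matrix (Fin 3) (Fin 3) ℂ)ᴴ *
          (A : Matrix (Fin 3) (Fin 3) ℂ)ᴴ) * formMatrix *
            ((A : Matrix (Fin 3) (Fin 3) ℂ) * (A⁻¹ : GL (Fin 3) ℂ)) := by
            simp only [Matrix.mul_assoc]
      _ = _ := by rw [h1, h2]; simp

/-- The subgroup `U(1)` of scalar matrices in `U(2,1)`: the centre of `GL(3, ℂ)` consists of the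
scalar matrices. -/
def scalars : Subgroup U21 := (Subgroup.center (GL (Fin 3) ℂ)).subgroupOf U21

instance : scalars.Normal := by unfold scalars; infer_instance

/-- The projective unitary group `PU(2,1) = U(2,1) / U(1)`. -/
abbrev PU21 : Type := U21 ⧸ scalars

theorem scalars_le_ker : scalars ≤ (MulAction.toPermHom U21 CP2).ker := by
  intro A hA
  have hA' : (A : GL (Fin 3) ℂ) ∈ Subgroup.center (GL (Fin 3) ℂ) := hA
  rw [Matrix.GeneralLinearGroup.center_eq_range_scalar] at hA'
  obtain ⟨u, hu⟩ := hA'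
  rw [MonoidHom.mem_ker]
  ext x
  induction x using Projectivization.ind with
  | h v hv =>
    change (A : GL (Fin 3) ℂ) • Projectivization.mk ℂ v hv = Projectivization.mk ℂ v hv
    rw [Projectivization.smul_mk, Projectivization.mk_eq_mk_iff]
    refine ⟨u, ?_⟩
    rw [← hu]
    ext i
    simp [Units.smul_def, Matrix.smul_eq_mulVec]

/-- The action of `PU(2,1)` on the projective plane: the class of `A` sends `[v]` to `[A v]`. -/
instance : MulAction PU21 CP2 :=
  MulAction.compHom CP2 (QuotientGroup.lift scalars (MulAction.toPermHom U21 CP2) scalars_le_ker)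

/-- The formula that defines the action. -/
theorem mk_smul_mk (A : U21) (v : V) (hv : v ≠ 0) :
    ((A : PU21) • Projectivization.mk ℂ v hv : CP2) =
      Projectivization.mk ℂ ((A : GL (Fin 3) ℂ) • v) ((smul_ne_zero_iff_ne _).mpr hv) := rfl

/-- An isometry is elliptic if it fixes a point of the complex hyperbolic plane. -/
def IsElliptic (f : PU21) : Prop := ∃ p ∈ hyperbolicPlane, f • p = p

/-- An elliptic isometry is regular if a matrix that represents it has three distinct
eigenvalues. (Two representatives differ by a scalar, so the choice does not matter.) -/
def IsRegularElliptic (f : PU21) : Prop :=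
  IsElliptic f ∧ ∃ A : U21, (A : PU21) = f ∧
    ∃ μ : Fin 3 → ℂ, Function.Injective μ ∧
      ∀ i, Module.End.HasEigenvalue
        (Matrix.toLin' ((A : GL (Fin 3) ℂ) : Matrix (Fin 3) (Fin 3) ℂ)) (μ i)

/-- The matrix `diag(e^{iθ}, e^{-iθ}, 1)` as an element of `GL(3, ℂ)`. -/
def diagRotationGL (θ : ℝ) : GL (Fin 3) ℂ where
  val := Matrix.diagonal ![Complex.exp (θ * Complex.I), Complex.exp (-(θ * Complex.I)), 1]
  inv := Matrix.diagonal ![Complex.exp (-(θ * Complex.I)), Complex.exp (θ * Complex.I), 1]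
  val_inv := by
    rw [Matrix.diagonal_mul_diagonal, ← Matrix.diagonal_one]
    congr 1
    ext i
    fin_cases i <;> simp [← Complex.exp_add]
  inv_val := by
    rw [Matrix.diagonal_mul_diagonal, ← Matrix.diagonal_one]
    congr 1
    ext i
    fin_cases i <;> simp [← Complex.exp_add]

/-- The matrix `diag(e^{iθ}, e^{-iθ}, 1)` as an element of `U(2,1)`. -/
def diagRotation (θ : ℝ) : U21 where
  val := diagRotationGL θ
  property := by
    change (diagRotationGL θ).valᴴ * formMatrix * (diagRotationGL θ).val = formMatrix
    rw [diagRotationGL, formMatrix, Matrix.diagonal_conjTranspose, Matrix.diagonal_mul_diagonal,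
      Matrix.diagonal_mul_diagonal]
    congr 1
    ext i
    fin_cases i <;>
      simp [← Complex.exp_add, ← Complex.exp_conj]

/-- An isometry is real elliptic if it is conjugate in `PU(2,1)` to the class of
`diag(e^{iθ}, e^{-iθ}, 1)` for some angle `θ`. -/
def IsRealElliptic (f : PU21) : Prop := ∃ θ : ℝ, IsConj f (diagRotation θ : PU21)

/-- A Lagrangian plane: the set of points of the complex hyperbolic plane with a lift in `W`, where
`W` is a totally real subspace of `ℂ^{2,1}` of real dimension three (the Hermitian form takes real
values on `W`) that contains a negative vector. These are the images under `PU(2,1)` of the real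
hyperbolic plane of points with real coordinates. -/
def IsLagrangianPlane (L : Set CP2) : Prop :=
  ∃ W : Submodule ℝ V, Module.finrank ℝ W = 3 ∧
    (∀ v ∈ W, ∀ w ∈ W, (herm v w).im = 0) ∧
    (∃ v ∈ W, (herm v v).re < 0) ∧
    L = {x | x ∈ hyperbolicPlane ∧ ∃ v ∈ W, ∃ hv : v ≠ 0, x = Projectivization.mk ℂ v hv}

/-- The ideal boundary of a set of points of the complex hyperbolic plane. -/
def idealBoundary (S : Set CP2) : Set CP2 := closure S ∩ boundary

/-- An `ℝ`-circle: the ideal boundary of a Lagrangian plane. -/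
def IsRCircle (C : Set CP2) : Prop := ∃ L, IsLagrangianPlane L ∧ C = idealBoundary L

/-- The Lagrangian planes through `p` that `f` preserves and on which `f` does not restrict to an
involution. -/
def preservedPlanes (f : PU21) (p : CP2) : Set (Set CP2) :=
  {L | IsLagrangianPlane L ∧ p ∈ L ∧ (fun x => f • x) '' L = L ∧ ¬ ∀ x ∈ L, f • f • x = x}

end ComplexHyperbolic

end

noncomputable section

namespace ComplexHyperbolic

open scoped Pointwise ComplexConjugate

/-! ### The action of `PU(2,1)` -/

/-! Everything in the statement is equivariant under `PU(2,1)`, which acts by homeomorphisms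
preserving the ball and its boundary, so `f` may be replaced by the class of `D = diag(e^{iθ},
e^{-iθ}, 1)`. Regularity becomes `sin θ ≠ 0` (`sin_ne_zero_of_isRegularElliptic`). In the affine
chart `D` is `(z, w) ↦ (e^{iθ} z, e^{-iθ} w)`, whose only fixed point in the ball is the origin.

Conjugation exchanges `e^{iθ}` and `e^{-iθ}`, so each plane `w = u z̄` with `|u| = 1` is invariant.
These are the only ones (`exists_eq_modelForm`, `exists_eq_modelPlane`): a real form `W` of an
invariant Lagrangian plane through the origin can be scaled to contain `(0, 0, 1)`. Then `D` maps
the vectors of `W` with last coordinate zero into `W`, and the reality of the form on such a vector,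
its image under `D` and an arbitrary element of `W` forces the equation `w = u z̄`.

The ideal boundary of `w = u z̄` is its part with `|z|² = 1/2`. Since `z ≠ 0` there, a point
determines `u`, so these circles are disjoint; they fill the torus `|z| = |w| = 1/√2`, which is
parameterised by `u` and the argument of `z`. -/

theorem herm_apply (v w : V) :
    herm v w = v 0 * conj (w 0) + v 1 * conj (w 1) - v 2 * conj (w 2) := by
  simp [herm, formMatrix, dotProduct, Fin.sum_univ_three, Matrix.mulVec_diagonal]
  ring

theorem herm_smul_smul (A : U21) (v w : V) :
    herm ((A : GL (Fin 3) ℂ) • v) ((A : GL (Fin 3) ℂ) • w) = herm v w := by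
  have hA : (A : GL (Fin 3) ℂ).valᴴ * formMatrix * (A : GL (Fin 3) ℂ).val = formMatrix := A.2
  change star ((A : GL (Fin 3) ℂ).val.mulVec w) ⬝ᵥ
    (formMatrix.mulVec ((A : GL (Fin 3) ℂ).val.mulVec v)) = star w ⬝ᵥ (formMatrix.mulVec v)
  conv_rhs => rw [← hA]
  rw [Matrix.star_mulVec, ← Matrix.mulVec_mulVec, ← Matrix.mulVec_mulVec, ← Matrix.dotProduct_mulVec]

theorem herm_smul_self (c : ℂ) (v : V) : herm (c • v) (c • v) = (Complex.normSq c : ℂ) * herm v v := by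
  simp only [herm_apply, Pi.smul_apply, smul_eq_mul, map_mul, Complex.normSq_eq_conj_mul_self]
  ring

theorem mk_mem_hyperbolicPlane {v : V} (hv : v ≠ 0) :
    Projectivization.mk ℂ v hv ∈ hyperbolicPlane ↔ (herm v v).re < 0 := by
  refine ⟨?_, fun h => ⟨v, hv, rfl, h⟩⟩
  rintro ⟨w, hw, h, hn⟩
  obtain ⟨a, rfl⟩ := (Projectivization.mk_eq_mk_iff' ℂ v w hv hw).1 h
  rw [herm_smul_self, Complex.re_ofReal_mul]
  exact mul_neg_of_pos_of_neg (Complex.normSq_pos.2 fun h0 => hv (by simp [h0])) hn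

theorem mk_mem_boundary {v : V} (hv : v ≠ 0) :
    Projectivization.mk ℂ v hv ∈ boundary ↔ herm v v = 0 := by
  refine ⟨?_, fun h => ⟨v, hv, rfl, h⟩⟩
  rintro ⟨w, hw, h, hn⟩
  obtain ⟨a, rfl⟩ := (Projectivization.mk_eq_mk_iff' ℂ v w hv hw).1 h
  rw [herm_smul_self, hn, mul_zero]

theorem smul_mem_hyperbolicPlane (g : PU21) (x : CP2) :
    g • x ∈ hyperbolicPlane ↔ x ∈ hyperbolicPlane := by
  induction g using QuotientGroup.induction_on with | H A => ?_
  induction x using Projectivization.ind with | h v hv => ?_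
  rw [mk_smul_mk, mk_mem_hyperbolicPlane, mk_mem_hyperbolicPlane, herm_smul_smul]

theorem smul_mem_boundary (g : PU21) (x : CP2) : g • x ∈ boundary ↔ x ∈ boundary := by
  induction g using QuotientGroup.induction_on with | H A => ?_
  induction x using Projectivization.ind with | h v hv => ?_
  rw [mk_smul_mk, mk_mem_boundary, mk_mem_boundary, herm_smul_smul]

theorem continuous_mk' : Continuous (Projectivization.mk' ℂ : {v : V // v ≠ 0} → CP2) :=
  continuous_coinduced_rng

instance : ContinuousConstSMul PU21 CP2 where
  continuous_const_smul g := by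
    induction g using QuotientGroup.induction_on with | H A => ?_
    refine continuous_coinduced_dom.2 ?_
    have h : Continuous fun v : {v : V // v ≠ 0} =>
        (⟨(A : GL (Fin 3) ℂ) • v.1, (smul_ne_zero_iff_ne _).mpr v.2⟩ : {v : V // v ≠ 0}) :=
      Continuous.subtype_mk (Continuous.matrix_mulVec continuous_const continuous_subtype_val) _
    exact continuous_mk'.comp h

theorem smul_boundary (g : PU21) : g • boundary = boundary := by
  ext x
  rw [Set.mem_smul_set_iff_inv_smul_mem, smul_mem_boundary]

theorem idealBoundary_smul (g : PU21) (S : Set CP2) :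
    idealBoundary (g • S) = g • idealBoundary S := by
  rw [idealBoundary, idealBoundary, closure_smul, Set.smul_set_inter, smul_boundary]

/-- An element of `U(2,1)` as a real-linear automorphism of `ℂ^{2,1}`. -/
def realLinearEquiv (A : U21) : V ≃ₗ[ℝ] V :=
  (DistribMulAction.toLinearEquiv ℂ V (A : GL (Fin 3) ℂ)).restrictScalars ℝ

theorem realLinearEquiv_apply (A : U21) (v : V) :
    realLinearEquiv A v = (A : GL (Fin 3) ℂ) • v := rfl

theorem IsLagrangianPlane.smul {L : Set CP2} (h : IsLagrangianPlane L) (g : PU21) :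
    IsLagrangianPlane (g • L) := by
  induction g using QuotientGroup.induction_on with | H A => ?_
  obtain ⟨W, hdim, hreal, ⟨n, hnW, hn⟩, rfl⟩ := h
  refine ⟨W.map (realLinearEquiv A : V →ₗ[ℝ] V), ?_, ?_, ?_, ?_⟩
  · rw [LinearEquiv.finrank_map_eq, hdim]
  · rintro _ ⟨v, hv, rfl⟩ _ ⟨w, hw, rfl⟩
    simp only [LinearEquiv.coe_coe, realLinearEquiv_apply, herm_smul_smul]
    exact hreal v hv w hw
  · refine ⟨_, ⟨n, hnW, rfl⟩, ?_⟩
    simpa only [LinearEquiv.coe_coe, realLinearEquiv_apply, herm_smul_smul] using hn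
  · ext x
    constructor
    · rintro ⟨_, ⟨hy, v, hvW, hv, rfl⟩, rfl⟩
      exact ⟨(smul_mem_hyperbolicPlane _ _).2 hy, _, ⟨v, hvW, rfl⟩,
        (realLinearEquiv A).map_ne_zero_iff.2 hv, rfl⟩
    · rintro ⟨hx, _, ⟨v, hvW, rfl⟩, hv, rfl⟩
      have hv' : v ≠ 0 := fun h => hv (by simp [h])
      exact ⟨Projectivization.mk ℂ v hv',
        ⟨(smul_mem_hyperbolicPlane (A : PU21) _).1 hx, v, hvW, hv', rfl⟩, rfl⟩

theorem smul_mem_preservedPlanes {f : PU21} {p : CP2} {L : Set CP2}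
    (h : L ∈ preservedPlanes f p) (g : PU21) :
    g • L ∈ preservedPlanes (g * f * g⁻¹) (g • p) := by
  obtain ⟨hL, hp, hf, hi⟩ := h
  refine ⟨hL.smul g, Set.smul_mem_smul_set hp, ?_, fun h => hi fun x hx => ?_⟩
  · change f • L = L at hf
    change (g * f * g⁻¹) • g • L = g • L
    rw [smul_smul, inv_mul_cancel_right, mul_smul, hf]
  · have := h (g • x) (Set.smul_mem_smul_set hx)
    rw [smul_smul, smul_smul, ← mul_assoc, inv_mul_cancel_right, mul_assoc, ← mul_assoc _ g f,
      inv_mul_cancel, one_mul, mul_assoc, mul_smul] at this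
    rw [smul_smul]
    exact MulAction.injective g this

/-- Reduces the classification of preserved planes to a diagonal representative of the conjugacy
class. -/
theorem preservedPlanes_conj (f g : PU21) (p : CP2) :
    preservedPlanes (g * f * g⁻¹) (g • p) = (fun L => g • L) '' preservedPlanes f p := by
  refine Set.Subset.antisymm (fun L hL => ⟨g⁻¹ • L, ?_, smul_inv_smul g L⟩) ?_
  · simpa [mul_assoc] using smul_mem_preservedPlanes hL g⁻¹
  · rintro _ ⟨L, hL, rfl⟩
    exact smul_mem_preservedPlanes hL g

/-! ### Regularity -/

/-- If `sin θ = 0` then `e^{iθ} = e^{-iθ}`, and a scalar multiple of the diagonal matrix has at most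
two eigenvalues, too few for three distinct `μ i`. -/
theorem sin_ne_zero_of_isRegularElliptic {f : PU21} (hreg : IsRegularElliptic f) {θ : ℝ}
    (hθ : IsConj f (diagRotation θ : PU21)) : Real.sin θ ≠ 0 := by
  intro hsin
  obtain ⟨-, A, rfl, μ, hμ, hev⟩ := hreg
  obtain ⟨c, hc⟩ := isConj_iff.1 hθ
  induction c using QuotientGroup.induction_on with | H C => ?_
  have hmem : (diagRotation θ)⁻¹ * (C * A * C⁻¹) ∈ scalars := QuotientGroup.eq.1 hc.symm
  have hmem' : (((diagRotation θ)⁻¹ * (C * A * C⁻¹) : U21) : GL (Fin 3) ℂ) ∈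
      Subgroup.center (GL (Fin 3) ℂ) := hmem
  rw [Matrix.GeneralLinearGroup.center_eq_range_scalar] at hmem'
  obtain ⟨u, hu⟩ := hmem'
  -- Conjugacy in the quotient group is conjugacy of matrices up to a scalar `u`.
  have hCA : (C : GL (Fin 3) ℂ) * A = diagRotationGL θ * Matrix.GeneralLinearGroup.scalar (Fin 3) u * C := by
    rw [hu]
    simp [diagRotation, mul_assoc]
  have hexp : Complex.exp (-(θ * Complex.I)) = Complex.exp (θ * Complex.I) := by
    rw [Complex.exp_mul_I, ← neg_mul, Complex.exp_mul_I, Complex.cos_neg, Complex.sin_neg,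
      ← Complex.ofReal_sin, hsin]
    simp
  have key : ∀ i, μ i = Complex.exp (θ * Complex.I) * u ∨ μ i = u := by
    intro i
    obtain ⟨v, hv⟩ := (hev i).exists_hasEigenvector
    have hAv : (A : GL (Fin 3) ℂ) • v = μ i • v := hv.apply_eq_smul
    have hne : (C : GL (Fin 3) ℂ) • v ≠ 0 := (smul_ne_zero_iff_ne _).mpr hv.2
    set w := (C : GL (Fin 3) ℂ) • v with hw
    have hDw : (diagRotationGL θ * Matrix.GeneralLinearGroup.scalar (Fin 3) u) • w = μ i • w := by
      rw [hw, smul_smul, ← hCA, mul_smul, hAv, smul_comm]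
    have h0 := congrFun hDw 0
    have h1 := congrFun hDw 1
    have h2 := congrFun hDw 2
    simp only [Units.smul_def, diagRotationGL, Matrix.smul_eq_mulVec, Units.val_mul,
      Matrix.GeneralLinearGroup.coe_scalar, Matrix.scalar_apply,
      Matrix.diagonal_mul_diagonal, Matrix.mulVec_diagonal, Pi.smul_apply, smul_eq_mul] at h0 h1 h2
    simp only [Matrix.cons_val_zero, Matrix.cons_val_one, Matrix.cons_val, hexp, one_mul] at h0 h1 h2
    -- The eigenvector equation is diagonal in the coordinates of `w`: were `μ i` different from
    -- both diagonal values, every coordinate of `w` would vanish.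
    by_contra! hcon
    refine hne (funext fun j => ?_)
    fin_cases j
    · exact (mul_eq_mul_right_iff.1 h0).resolve_left (Ne.symm hcon.1)
    · exact (mul_eq_mul_right_iff.1 h1).resolve_left (Ne.symm hcon.1)
    · exact (mul_eq_mul_right_iff.1 h2).resolve_left (Ne.symm hcon.2)
  have h01 := hμ.ne (show (0 : Fin 3) ≠ 1 by decide)
  have h02 := hμ.ne (show (0 : Fin 3) ≠ 2 by decide)
  have h12 := hμ.ne (show (1 : Fin 3) ≠ 2 by decide)
  rcases key 0 with h0 | h0 <;> rcases key 1 with h1 | h1 <;> rcases key 2 with h2 | h2 <;>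
    first
    | exact h01 (h0.trans h1.symm)
    | exact h02 (h0.trans h2.symm)
    | exact h12 (h1.trans h2.symm)

/-! ### Points in the affine chart -/

/-- The point of the projective plane with affine coordinates `(z, w)`. -/
def affinePt (z w : ℂ) : CP2 :=
  Projectivization.mk ℂ ![z, w, 1] fun h => one_ne_zero (congrFun h 2)

theorem mk_eq_affinePt {v : V} (hv : v ≠ 0) {z w : ℂ} :
    Projectivization.mk ℂ v hv = affinePt z w ↔ v 0 = v 2 * z ∧ v 1 = v 2 * w := by
  rw [affinePt, Projectivization.mk_eq_mk_iff']
  constructor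
  · rintro ⟨a, rfl⟩
    simp
  · rintro ⟨h0, h1⟩
    refine ⟨v 2, funext fun i => ?_⟩
    fin_cases i <;> simp [h0, h1]

theorem affinePt_inj {z w z' w' : ℂ} : affinePt z w = affinePt z' w' ↔ z = z' ∧ w = w' := by
  conv_lhs => lhs; rw [affinePt]
  rw [mk_eq_affinePt]
  simp

theorem continuous_affinePt : Continuous fun p : ℂ × ℂ => affinePt p.1 p.2 := by
  have h : Continuous fun p : ℂ × ℂ => (⟨![p.1, p.2, 1], fun h => one_ne_zero (congrFun h 2)⟩ :
      {v : V // v ≠ 0}) := by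
    refine Continuous.subtype_mk (continuous_pi fun i => ?_) _
    fin_cases i
    · exact continuous_fst
    · exact continuous_snd
    · exact continuous_const
  exact continuous_mk'.comp h

theorem herm_self (v : V) : herm v v =
    ((Complex.normSq (v 0) + Complex.normSq (v 1) - Complex.normSq (v 2) : ℝ) : ℂ) := by
  simp [herm_apply, Complex.mul_conj]

theorem affinePt_mem_hyperbolicPlane {z w : ℂ} :
    affinePt z w ∈ hyperbolicPlane ↔ Complex.normSq z + Complex.normSq w < 1 := by
  rw [affinePt, mk_mem_hyperbolicPlane, herm_self, Complex.ofReal_re]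
  simp

theorem affinePt_mem_boundary {z w : ℂ} :
    affinePt z w ∈ boundary ↔ Complex.normSq z + Complex.normSq w = 1 := by
  rw [affinePt, mk_mem_boundary, herm_self, Complex.ofReal_eq_zero]
  simp [sub_eq_zero]

/-! ### The model planes and their ideal boundaries -/

/-- The plane of points with affine coordinates `(z, u z̄)`. -/
def modelPlane (u : Circle) : Set CP2 :=
  {x | ∃ z : ℂ, 2 * Complex.normSq z < 1 ∧ x = affinePt z (u * conj z)}

theorem normSq_circle_mul_conj (u : Circle) (z : ℂ) :
    Complex.normSq (u * conj z) = Complex.normSq z := by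
  simp [Complex.normSq_conj]

/-- The preimage in `V \ {0}` is cut out by closed conditions on homogeneous coordinates. The first
is `w = u z̄` with denominators cleared, which is vacuous when `v 2 = 0`; the other two exclude that
case, since they would then give `v = 0`. -/
theorem isClosed_closedModelPlane (u : Circle) :
    IsClosed {x | ∃ z : ℂ, 2 * Complex.normSq z ≤ 1 ∧ x = affinePt z (u * conj z)} := by
  rw [isClosed_coinduced]
  have h : (Projectivization.mk' ℂ : {v : V // v ≠ 0} → CP2) ⁻¹'
      {x | ∃ z : ℂ, 2 * Complex.normSq z ≤ 1 ∧ x = affinePt z (u * conj z)} =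
      {v | v.1 1 * conj (v.1 2) = (u : ℂ) * conj (v.1 0) * v.1 2} ∩
      ({v | Complex.normSq (v.1 1) = Complex.normSq (v.1 0)} ∩
      {v | 2 * Complex.normSq (v.1 0) ≤ Complex.normSq (v.1 2)}) := by
    ext ⟨v, hv⟩
    constructor
    · rintro ⟨z, hz, h⟩
      obtain ⟨h0, h1⟩ := (mk_eq_affinePt hv).1 h
      refine ⟨?_, ?_, ?_⟩
      · change v 1 * conj (v 2) = u * conj (v 0) * v 2
        rw [h0, h1, map_mul]
        ring
      · change Complex.normSq (v 1) = Complex.normSq (v 0)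
        rw [h0, h1, Complex.normSq_mul, normSq_circle_mul_conj, Complex.normSq_mul]
      · change 2 * Complex.normSq (v 0) ≤ Complex.normSq (v 2)
        rw [h0, Complex.normSq_mul]
        nlinarith [Complex.normSq_nonneg (v 2)]
    · rintro ⟨h1, h2, h3⟩
      change v 1 * conj (v 2) = u * conj (v 0) * v 2 at h1
      change Complex.normSq (v 1) = Complex.normSq (v 0) at h2
      change 2 * Complex.normSq (v 0) ≤ Complex.normSq (v 2) at h3
      have hv2 : v 2 ≠ 0 := by
        intro h
        rw [h, map_zero] at h3
        have h0 : v 0 = 0 := Complex.normSq_eq_zero.1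
          (le_antisymm (by linarith) (Complex.normSq_nonneg _))
        rw [h0, map_zero, Complex.normSq_eq_zero] at h2
        refine hv (funext fun i => ?_)
        fin_cases i
        exacts [h0, h2, h]
      refine ⟨v 0 / v 2, ?_, (mk_eq_affinePt hv).2 ⟨?_, ?_⟩⟩
      · rw [Complex.normSq_div, ← mul_div_assoc]
        exact div_le_one_of_le₀ h3 (Complex.normSq_nonneg _)
      · field_simp
      · have hc : conj (v 2) ≠ 0 := (map_ne_zero _).2 hv2
        rw [map_div₀]
        field_simp
        linear_combination h1
  rw [h]
  have hc : ∀ i, Continuous fun v : {v : V // v ≠ 0} => v.1 i := fun i =>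
    (continuous_apply i).comp continuous_subtype_val
  have hn : ∀ i, Continuous fun v : {v : V // v ≠ 0} => Complex.normSq (v.1 i) := fun i =>
    Complex.continuous_normSq.comp (hc i)
  refine (isClosed_eq ?_ ?_).inter ((isClosed_eq (hn 1) (hn 0)).inter
    (isClosed_le (continuous_const.mul (hn 0)) (hn 2)))
  · exact (hc 1).mul (Complex.continuous_conj.comp (hc 2))
  · exact (continuous_const.mul (Complex.continuous_conj.comp (hc 0))).mul (hc 2)

/-- Closedness of the closed disc bounds the closure from above; conversely each boundary point is
the limit of the radial points `s z` as `s → 1`. -/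
theorem idealBoundary_modelPlane (u : Circle) : idealBoundary (modelPlane u) =
    {x | ∃ z : ℂ, 2 * Complex.normSq z = 1 ∧ x = affinePt z (u * conj z)} := by
  ext x
  constructor
  · rintro ⟨hx, hb⟩
    obtain ⟨z, -, rfl⟩ := closure_minimal
      (fun y (hy : y ∈ modelPlane u) => hy.imp fun z h => ⟨h.1.le, h.2⟩) (isClosed_closedModelPlane u) hx
    rw [affinePt_mem_boundary, normSq_circle_mul_conj] at hb
    exact ⟨z, by linarith, rfl⟩
  · rintro ⟨z, hz, rfl⟩
    refine ⟨?_, ?_⟩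
    · have hcont : Continuous fun s : ℝ => affinePt (s * z) (u * conj (s * z)) :=
        continuous_affinePt.comp (f := fun s : ℝ => ((s * z : ℂ), (u * conj (s * z) : ℂ)))
          (by fun_prop)
      have h1 : (1 : ℝ) ∈ closure (Set.Ioo 0 1) := by
        rw [closure_Ioo zero_ne_one]
        simp
      have hmaps : Set.MapsTo (fun s : ℝ => affinePt (s * z) (u * conj (s * z))) (Set.Ioo 0 1)
          (modelPlane u) := by
        rintro s ⟨hs0, hs1⟩
        refine ⟨s * z, ?_, rfl⟩
        rw [Complex.normSq_mul, Complex.normSq_ofReal]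
        nlinarith
      simpa using map_mem_closure hcont h1 hmaps
    · rw [affinePt_mem_boundary, normSq_circle_mul_conj]
      linarith

theorem disjoint_idealBoundary_modelPlane {u u' : Circle} (h : u ≠ u') :
    Disjoint (idealBoundary (modelPlane u)) (idealBoundary (modelPlane u')) := by
  rw [idealBoundary_modelPlane, idealBoundary_modelPlane, Set.disjoint_left]
  rintro _ ⟨z, hz, rfl⟩ ⟨z', -, hx⟩
  obtain ⟨rfl, h2⟩ := affinePt_inj.1 hx
  have hz0 : conj z ≠ 0 := by
    rw [Ne, map_eq_zero]
    rintro rfl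
    simp at hz
  exact h (Circle.ext (mul_right_cancel₀ hz0 h2))

/-- Equal planes with different parameters would have an ideal boundary disjoint from itself, yet it
contains the point with `z = 1/√2`. -/
theorem modelPlane_injective : Function.Injective modelPlane := by
  intro u u' h
  by_contra hne
  have hd := disjoint_idealBoundary_modelPlane hne
  rw [h, disjoint_self, idealBoundary_modelPlane, Set.bot_eq_empty,
    Set.eq_empty_iff_forall_notMem] at hd
  refine hd _ ⟨((√2)⁻¹ : ℝ), ?_, rfl⟩
  rw [Complex.normSq_ofReal, ← mul_inv, Real.mul_self_sqrt (by norm_num)]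
  norm_num

/-! ### The model planes are Lagrangian -/

/-- The points of the complex hyperbolic plane with a lift in `W`. -/
def planeOf (W : Submodule ℝ V) : Set CP2 :=
  {x | x ∈ hyperbolicPlane ∧ ∃ v ∈ W, ∃ hv : v ≠ 0, x = Projectivization.mk ℂ v hv}

/-- The real form `{(z, u z̄, t) | z ∈ ℂ, t ∈ ℝ}` of `ℂ^{2,1}`. -/
def modelForm (u : Circle) : Submodule ℝ V where
  carrier := {v | v 1 = u * conj (v 0) ∧ (v 2).im = 0}
  zero_mem' := by simp
  add_mem' := by
    rintro v w ⟨hv, hv'⟩ ⟨hw, hw'⟩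
    exact ⟨by simp [hv, hw, mul_add], by simp [hv', hw']⟩
  smul_mem' := by
    rintro c v ⟨hv, hv'⟩
    exact ⟨by simp [hv]; ring, by simp [hv']⟩

theorem mem_modelForm {u : Circle} {v : V} :
    v ∈ modelForm u ↔ v 1 = u * conj (v 0) ∧ (v 2).im = 0 := Iff.rfl

/-- Real-linear coordinates on the model real form. -/
def modelFormEquiv (u : Circle) : modelForm u ≃ₗ[ℝ] ℂ × ℝ where
  toFun v := (v.1 0, (v.1 2).re)
  map_add' v w := by simp
  map_smul' c v := by simp
  invFun p := ⟨![p.1, u * conj p.1, p.2], by simp [mem_modelForm]⟩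
  left_inv := by
    rintro ⟨v, hv, hv'⟩
    ext i
    fin_cases i
    · rfl
    · exact hv.symm
    · exact Complex.ext rfl hv'.symm
  right_inv p := rfl

theorem finrank_modelForm (u : Circle) : Module.finrank ℝ (modelForm u) = 3 := by
  rw [(modelFormEquiv u).finrank_eq, Module.finrank_prod, Complex.finrank_real_complex,
    Module.finrank_self]

theorem planeOf_modelForm (u : Circle) : planeOf (modelForm u) = modelPlane u := by
  ext x
  constructor
  · rintro ⟨hx, v, ⟨h1, h2⟩, hv, rfl⟩
    rw [mk_mem_hyperbolicPlane, herm_self, Complex.ofReal_re, h1, normSq_circle_mul_conj] at hx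
    have hv2 : v 2 ≠ 0 := by
      intro h
      rw [h, map_zero] at hx
      linarith [Complex.normSq_nonneg (v 0)]
    have hc : conj (v 2) = v 2 := Complex.conj_eq_iff_im.2 h2
    refine ⟨v 0 / v 2, ?_, (mk_eq_affinePt hv).2 ⟨?_, ?_⟩⟩
    · rw [Complex.normSq_div, ← mul_div_assoc, div_lt_one (Complex.normSq_pos.2 hv2)]
      linarith
    · field_simp
    · rw [map_div₀, hc, h1]
      field_simp
  · rintro ⟨z, hz, rfl⟩
    refine ⟨?_, _, ?_, _, rfl⟩
    · rw [affinePt_mem_hyperbolicPlane, normSq_circle_mul_conj]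
      linarith
    · simp [mem_modelForm]

/-- On the real form, `|u| = 1` makes the first two terms of `⟨v, w⟩` complex conjugates of each
other, and the third is real. -/
theorem isLagrangianPlane_modelPlane (u : Circle) : IsLagrangianPlane (modelPlane u) := by
  refine ⟨modelForm u, finrank_modelForm u, ?_, ⟨![0, 0, 1], by simp [mem_modelForm], ?_⟩,
    (planeOf_modelForm u).symm⟩
  · rintro v ⟨hv, hv'⟩ w ⟨hw, hw'⟩
    have hu : (u : ℂ) * conj (u : ℂ) = 1 := by
      rw [Complex.mul_conj, Circle.normSq_coe, Complex.ofReal_one]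
    rw [← Complex.conj_eq_iff_im, herm_apply, hv, hw]
    simp only [map_sub, map_add, map_mul, Complex.conj_conj, Complex.conj_eq_iff_im.2 hv',
      Complex.conj_eq_iff_im.2 hw']
    linear_combination (v 0 * conj (w 0) - conj (v 0) * w 0) * hu
  · rw [herm_self, Complex.ofReal_re]
    simp

/-! ### The planes preserved by a diagonal rotation -/

theorem diagRotation_smul (θ : ℝ) (v : V) : (diagRotation θ : GL (Fin 3) ℂ) • v =
    ![Complex.exp (θ * Complex.I) * v 0, Complex.exp (-(θ * Complex.I)) * v 1, v 2] := by
  change (diagRotationGL θ).val.mulVec v = _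
  ext i
  fin_cases i <;> simp [diagRotationGL, Matrix.mulVec_diagonal]

theorem diagRotation_smul_affinePt (θ : ℝ) (z w : ℂ) :
    (diagRotation θ : PU21) • affinePt z w =
      affinePt (Complex.exp (θ * Complex.I) * z) (Complex.exp (-(θ * Complex.I)) * w) := by
  rw [affinePt, mk_smul_mk, mk_eq_affinePt, diagRotation_smul]
  simp

theorem conj_exp_mul_I (θ : ℝ) :
    conj (Complex.exp (θ * Complex.I)) = Complex.exp (-(θ * Complex.I)) := by
  simp [← Complex.exp_conj]

theorem exp_mul_I_ne_one {θ : ℝ} (hθ : Real.sin θ ≠ 0) : Complex.exp (θ * Complex.I) ≠ 1 := by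
  intro h
  apply hθ
  rw [← Complex.exp_ofReal_mul_I_im, h, Complex.one_im]

theorem fixed_iff_of_sin_ne_zero {θ : ℝ} (hθ : Real.sin θ ≠ 0) (q : CP2) :
    (q ∈ hyperbolicPlane ∧ (diagRotation θ : PU21) • q = q) ↔ q = affinePt 0 0 := by
  constructor
  · rintro ⟨hq, hfix⟩
    induction q using Projectivization.ind with | h v hv => ?_
    rw [mk_mem_hyperbolicPlane, herm_self, Complex.ofReal_re] at hq
    have hv2 : v 2 ≠ 0 := by
      intro h
      rw [h, map_zero] at hq
      linarith [Complex.normSq_nonneg (v 0), Complex.normSq_nonneg (v 1)]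
    have hq' : Projectivization.mk ℂ v hv = affinePt (v 0 / v 2) (v 1 / v 2) :=
      (mk_eq_affinePt hv).2 ⟨by field_simp, by field_simp⟩
    rw [hq', diagRotation_smul_affinePt, affinePt_inj, mul_left_eq_self₀, mul_left_eq_self₀] at hfix
    have h1 := exp_mul_I_ne_one hθ
    rw [Complex.exp_neg, inv_eq_one] at hfix
    rw [hq', hfix.1.resolve_left h1, hfix.2.resolve_left h1]
  · rintro rfl
    rw [affinePt_mem_hyperbolicPlane, diagRotation_smul_affinePt]
    simp

theorem modelPlane_mem_preservedPlanes {θ : ℝ} (hθ : Real.sin θ ≠ 0) (u : Circle) :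
    modelPlane u ∈ preservedPlanes (diagRotation θ : PU21) (affinePt 0 0) := by
  -- Stated for all angles, so that the angle `-θ` supplies preimages for surjectivity.
  have hsub : ∀ θ : ℝ, ∀ x ∈ modelPlane u, (diagRotation θ : PU21) • x ∈ modelPlane u := by
    rintro θ _ ⟨z, hz, rfl⟩
    refine ⟨Complex.exp (θ * Complex.I) * z, ?_, ?_⟩
    · rwa [Complex.normSq_mul, Complex.normSq_eq_norm_sq (Complex.exp _),
        Complex.norm_exp_ofReal_mul_I, one_pow, one_mul]
    · rw [diagRotation_smul_affinePt, map_mul, conj_exp_mul_I]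
      congr 1
      ring
  refine ⟨isLagrangianPlane_modelPlane u, ⟨0, by simp, by simp⟩, ?_, fun h => ?_⟩
  · refine Set.Subset.antisymm (Set.image_subset_iff.2 (hsub θ)) fun x hx => ?_
    refine ⟨_, hsub (-θ) x hx, ?_⟩
    obtain ⟨z, -, rfl⟩ := hx
    simp only [diagRotation_smul_affinePt, ← mul_assoc, ← Complex.exp_add]
    simp
  -- Any point of the plane with `z ≠ 0` would do: if the square fixes it then `e^{2iθ} = 1`, so
  -- `e^{iθ} = ±1` and `sin θ = 0`.
  · have h2 := h (affinePt (1 / 2 : ℝ) (u * conj ((1 / 2 : ℝ) : ℂ)))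
      ⟨_, by rw [Complex.normSq_ofReal]; norm_num, rfl⟩
    rw [diagRotation_smul_affinePt, diagRotation_smul_affinePt, affinePt_inj, ← mul_assoc,
      ← mul_assoc] at h2
    have h3 : Complex.exp (θ * Complex.I) * Complex.exp (θ * Complex.I) = 1 :=
      (mul_left_eq_self₀.1 h2.1).resolve_right (by norm_num)
    rw [← Complex.exp_ofReal_mul_I_im] at hθ
    rcases mul_self_eq_one_iff.1 h3 with h | h <;> simp [h] at hθ

/-- One nonzero `v ∈ W` with `v 2 = 0` determines `u = v 1 / conj (v 0)`. Pairing any `x ∈ W` with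
`v` and `D v` gives two real equations which put `x` in `modelForm u`; equality follows by
dimension. -/
theorem exists_eq_modelForm {θ : ℝ} (hθ : Real.sin θ ≠ 0) {W : Submodule ℝ V}
    (hdim : Module.finrank ℝ W = 3) (hreal : ∀ v ∈ W, ∀ w ∈ W, (herm v w).im = 0)
    (hinv : ∀ v ∈ W, v 2 = 0 → (diagRotation θ : GL (Fin 3) ℂ) • v ∈ W)
    (he : ![0, 0, 1] ∈ W) : ∃ u, W = modelForm u := by
  have hW2 : ∀ w ∈ W, (w 2).im = 0 := by
    intro w hw
    simpa [herm_apply] using hreal w hw _ he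
  -- Last coordinates on `W` are real, so subtracting a real multiple of `(0, 0, 1)` kills them;
  -- without such a `v`, `W` would be at most a line.
  obtain ⟨v, hvW, hv2, hv0⟩ : ∃ v ∈ W, v 2 = 0 ∧ v ≠ 0 := by
    by_contra! hcon
    have hle : W ≤ Submodule.span ℝ {![0, 0, 1]} := by
      intro w hw
      have h := hcon (w - (w 2).re • ![0, 0, 1]) (W.sub_mem hw (W.smul_mem _ he)) (by
        simp [Complex.ext_iff, hW2 w hw])
      rw [sub_eq_zero.1 h]
      exact Submodule.smul_mem _ _ (Submodule.mem_span_singleton_self _)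
    have h1 := (Submodule.finrank_mono hle).trans (finrank_span_le_card _)
    rw [hdim] at h1
    simp at h1
  have hDv := hinv v hvW hv2
  have hvv := hreal _ hDv _ hvW
  rw [diagRotation_smul] at hDv hvv
  have hnorm : Complex.normSq (v 1) = Complex.normSq (v 0) := by
    -- This is the imaginary part of `⟨D v, v⟩ = e^{iθ} |v 0|² + e^{-iθ} |v 1|²`.
    have h : Real.sin θ * (Complex.normSq (v 0) - Complex.normSq (v 1)) = 0 := by
      rw [← hvv, herm_apply]
      simp only [Matrix.cons_val_zero, Matrix.cons_val_one, Matrix.cons_val, hv2, mul_assoc,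
        Complex.mul_conj, ← neg_mul, ← Complex.ofReal_neg]
      simp [Complex.exp_ofReal_mul_I_im, -Complex.ofReal_neg]
      ring
    linarith [(mul_eq_zero.1 h).resolve_left hθ]
  have ha : v 0 ≠ 0 := by
    intro h
    rw [h, map_zero, Complex.normSq_eq_zero] at hnorm
    refine hv0 (funext fun i => ?_)
    fin_cases i
    exacts [h, hnorm, hv2]
  have hca : conj (v 0) ≠ 0 := (map_ne_zero _).2 ha
  have hu : ‖v 1 / conj (v 0)‖ = 1 := by
    rw [norm_div, Complex.norm_conj, div_eq_one_iff_eq (norm_ne_zero_iff.2 ha)]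
    rw [Complex.normSq_eq_norm_sq, Complex.normSq_eq_norm_sq] at hnorm
    exact (sq_eq_sq₀ (norm_nonneg _) (norm_nonneg _)).1 hnorm
  refine ⟨⟨v 1 / conj (v 0), mem_sphere_zero_iff_norm.2 hu⟩, ?_⟩
  refine Submodule.eq_of_le_of_finrank_eq (fun x hx => ⟨?_, hW2 x hx⟩)
    (hdim.trans (finrank_modelForm _).symm)
  change x 1 = v 1 / conj (v 0) * conj (x 0)
  have h1 := hreal x hx v hvW
  have h2 := hreal x hx _ hDv
  rw [herm_apply, hv2] at h1
  rw [herm_apply] at h2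
  simp only [Matrix.cons_val_zero, Matrix.cons_val_one, Matrix.cons_val, hv2, map_zero, mul_zero,
    sub_zero, map_mul, ← conj_exp_mul_I, Complex.conj_conj] at h1 h2
  -- With `X = x 0 * conj (v 0)` and `Y = x 1 * conj (v 1)`, both `X + Y` and `e^{-iθ} X + e^{iθ} Y`
  -- are real. As `sin θ ≠ 0`, this says `Y = conj X`.
  have hXY : conj (x 0 * conj (v 0)) = x 1 * conj (v 1) := by
    have hcos := Complex.exp_ofReal_mul_I_re θ
    have hsin := Complex.exp_ofReal_mul_I_im θ
    rw [mul_left_comm, mul_left_comm (x 1)] at h2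
    generalize Complex.exp (θ * Complex.I) = E at hcos hsin h2
    generalize x 0 * conj (v 0) = X at h1 h2 ⊢
    generalize x 1 * conj (v 1) = Y at h1 h2 ⊢
    simp only [Complex.add_im, Complex.mul_im, Complex.conj_re, Complex.conj_im, hcos, hsin]
      at h1 h2
    have h3 : Real.sin θ * (X.re - Y.re) = 0 := by
      linear_combination Real.cos θ * h1 - h2
    refine Complex.ext ?_ ?_
    · exact sub_eq_zero.1 ((mul_eq_zero.1 h3).resolve_left hθ)
    · rw [Complex.conj_im]
      linarith
  rw [map_mul, Complex.conj_conj] at hXY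
  have hb : v 1 * conj (v 1) = v 0 * conj (v 0) := by
    rw [Complex.mul_conj, Complex.mul_conj, hnorm]
  have : x 1 * (v 0 * conj (v 0)) = v 1 * conj (x 0) * v 0 := by
    linear_combination (-v 1) * hXY - x 1 * hb
  rw [div_mul_eq_mul_div, eq_div_iff hca]
  refine mul_right_cancel₀ ha ?_
  linear_combination this

/-- A lift of the plane is unique only up to scale, so it is divided by the last coordinate of a
lift `e` of the origin. Invariance of the plane then has to be upgraded from points to vectors, as
`exists_eq_modelForm` requires. -/
theorem exists_eq_modelPlane {θ : ℝ} (hθ : Real.sin θ ≠ 0) {L : Set CP2}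
    (hL : IsLagrangianPlane L) (hp : affinePt 0 0 ∈ L)
    (hf : (diagRotation θ : PU21) • L = L) : ∃ u, L = modelPlane u := by
  obtain ⟨W₀, hdim₀, hreal₀, -, rfl⟩ := hL
  obtain ⟨-, e, heW, he, hpe⟩ := id hp
  obtain ⟨he0, he1⟩ := (mk_eq_affinePt he).1 hpe.symm
  have hc : e 2 ≠ 0 := by
    intro h
    refine he (funext fun i => ?_)
    fin_cases i
    exacts [by simp [he0], by simp [he1], h]
  let m : V ≃ₗ[ℝ] V := (LinearEquiv.smulOfNeZero ℂ V (e 2)⁻¹ (inv_ne_zero hc)).restrictScalars ℝ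
  have hm : ∀ v, m v = (e 2)⁻¹ • v := fun v => rfl
  let W := W₀.map (m : V →ₗ[ℝ] V)
  have hWL : planeOf W₀ = planeOf W := by
    ext x
    refine and_congr_right fun _ => ⟨?_, ?_⟩
    · rintro ⟨v, hvW, hv, rfl⟩
      refine ⟨_, ⟨v, hvW, rfl⟩, m.map_ne_zero_iff.2 hv, ?_⟩
      exact (Projectivization.mk_eq_mk_iff' ..).2 ⟨e 2, by simp [hm, hc]⟩
    · rintro ⟨_, ⟨v, hvW, rfl⟩, hv, rfl⟩
      refine ⟨v, hvW, m.map_ne_zero_iff.1 hv, ?_⟩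
      exact (Projectivization.mk_eq_mk_iff' ..).2 ⟨(e 2)⁻¹, rfl⟩
  have hdim : Module.finrank ℝ W = 3 := by rw [LinearEquiv.finrank_map_eq, hdim₀]
  have hreal : ∀ v ∈ W, ∀ w ∈ W, (herm v w).im = 0 := by
    rintro _ ⟨v, hv, rfl⟩ _ ⟨w, hw, rfl⟩
    have : herm ((e 2)⁻¹ • v) ((e 2)⁻¹ • w) = (Complex.normSq (e 2)⁻¹ : ℝ) * herm v w := by
      simp only [herm_apply, Pi.smul_apply, smul_eq_mul, map_mul, Complex.normSq_eq_conj_mul_self]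
      ring
    simp only [LinearEquiv.coe_coe, hm, this, Complex.im_ofReal_mul, hreal₀ v hv w hw, mul_zero]
  have heW' : ![0, 0, 1] ∈ W := by
    refine ⟨e, heW, ?_⟩
    ext i
    fin_cases i <;> simp [hm, he0, he1, hc]
  change (diagRotation θ : PU21) • planeOf W₀ = planeOf W₀ at hf
  change ∃ u, planeOf W₀ = modelPlane u
  rw [hWL] at hf ⊢
  suffices hinv : ∀ v ∈ W, v 2 = 0 → (diagRotation θ : GL (Fin 3) ℂ) • v ∈ W by
    obtain ⟨u, hu⟩ := exists_eq_modelForm hθ hdim hreal hinv heW'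
    exact ⟨u, by rw [hu, planeOf_modelForm]⟩
  intro w hw hw2
  -- Since `t ≥ 1`, `t² ≥ t > |w 0|² + |w 1|²`, so `w + t (0, 0, 1)` is negative and represents a
  -- point of the plane.
  set t : ℝ := Complex.normSq (w 0) + Complex.normSq (w 1) + 1 with ht
  have ht1 : 1 ≤ t := by linarith [Complex.normSq_nonneg (w 0), Complex.normSq_nonneg (w 1)]
  have ht0 : t ≠ 0 := by linarith
  have hxW : w + t • ![0, 0, 1] ∈ W := W.add_mem hw (W.smul_mem _ heW')
  have hx0 : w + t • ![0, 0, 1] ≠ 0 := fun h => ht0 (by simpa [hw2] using congrFun h 2)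
  have hxL : Projectivization.mk ℂ _ hx0 ∈ planeOf W := by
    refine ⟨?_, _, hxW, hx0, rfl⟩
    rw [mk_mem_hyperbolicPlane, herm_self, Complex.ofReal_re]
    simp [hw2, Complex.normSq_ofReal]
    nlinarith
  have hDx : (diagRotation θ : PU21) • Projectivization.mk ℂ _ hx0 ∈ planeOf W := by
    rw [← hf]
    exact Set.smul_mem_smul_set hxL
  obtain ⟨-, y, hyW, hy0, hy⟩ := hDx
  rw [mk_smul_mk, eq_comm, Projectivization.mk_eq_mk_iff'] at hy
  obtain ⟨a, rfl⟩ := hy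
  rw [diagRotation_smul] at hyW hy0 ⊢
  have ha : a ≠ 0 := fun h => hy0 (by simp [h])
  -- The lift in `W` of the image point is `a` times the image vector, whose last coordinate is `t`.
  -- Pairing it with `(0, 0, 1)` gives `-a t`, so `a` is real and can be divided out inside `W`.
  have hare : a.im = 0 := by
    have := hreal _ hyW _ heW'
    simpa [herm_apply, hw2, ht0] using this
  have ha' : (a.re : ℂ) = a := Complex.ext rfl hare.symm
  have hare0 : a.re ≠ 0 := fun h => ha (by rw [← ha', h, Complex.ofReal_zero])
  convert W.sub_mem (W.smul_mem (a.re)⁻¹ hyW) (W.smul_mem t heW') using 1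
  rw [← ha']
  ext i
  fin_cases i <;> simp [hare0, hw2]

theorem preservedPlanes_diagRotation {θ : ℝ} (hθ : Real.sin θ ≠ 0) :
    preservedPlanes (diagRotation θ : PU21) (affinePt 0 0) = Set.range modelPlane := by
  refine Set.Subset.antisymm ?_ (Set.range_subset_iff.2 (modelPlane_mem_preservedPlanes hθ))
  rintro L ⟨hL, hp, hf, -⟩
  obtain ⟨u, rfl⟩ := exists_eq_modelPlane hθ hL hp hf
  exact ⟨u, rfl⟩

/-! ### The torus -/

theorem toCircle_injective : Function.Injective Real.Angle.toCircle :=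
  AddCircle.homeomorphCircle'.injective

theorem toCircle_surjective : Function.Surjective Real.Angle.toCircle :=
  AddCircle.homeomorphCircle'.surjective

theorem continuous_angle_toCircle : Continuous Real.Angle.toCircle :=
  AddCircle.homeomorphCircle'.continuous

instance : CompactSpace Real.Angle :=
  haveI : Fact (0 < 2 * Real.pi) := ⟨Real.two_pi_pos⟩
  inferInstanceAs (CompactSpace (AddCircle (2 * Real.pi)))

/-- The radius `1 / √2` of the two circles whose product is the torus. -/
def torusRadius : ℝ := (√2)⁻¹

theorem torusRadius_mul_self : torusRadius * torusRadius = 1 / 2 := by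
  rw [torusRadius, ← mul_inv, Real.mul_self_sqrt (by norm_num), one_div]

theorem torusRadius_ne_zero : torusRadius ≠ 0 := fun h => by
  have := torusRadius_mul_self
  norm_num [h] at this

/-- The parameterisation of the torus `|z| = |w| = 1 / √2`. -/
def angleTorusMap (p : Real.Angle × Real.Angle) : CP2 :=
  affinePt (torusRadius * p.2.toCircle) (p.1.toCircle * conj (torusRadius * p.2.toCircle : ℂ))

theorem image_angleTorusMap (θ : Real.Angle) :
    angleTorusMap '' ({θ} ×ˢ Set.univ) = idealBoundary (modelPlane θ.toCircle) := by
  rw [idealBoundary_modelPlane]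
  ext x
  constructor
  · rintro ⟨⟨θ', φ⟩, ⟨hθ, -⟩, rfl⟩
    obtain rfl : θ' = θ := hθ
    refine ⟨_, ?_, rfl⟩
    rw [Complex.normSq_mul, Circle.normSq_coe, Complex.normSq_ofReal, torusRadius_mul_self]
    norm_num
  · rintro ⟨z, hz, rfl⟩
    have hz1 : ‖z / torusRadius‖ = 1 := by
      rw [← sq_eq_sq₀ (norm_nonneg _) zero_le_one, ← Complex.normSq_eq_norm_sq,
        Complex.normSq_div, Complex.normSq_ofReal, torusRadius_mul_self]
      linarith
    obtain ⟨φ, hφ⟩ := toCircle_surjective ⟨z / torusRadius, mem_sphere_zero_iff_norm.2 hz1⟩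
    have hr : (torusRadius : ℂ) ≠ 0 := Complex.ofReal_ne_zero.2 torusRadius_ne_zero
    have hz2 : torusRadius * (φ.toCircle : ℂ) = z := by
      rw [hφ]
      change (torusRadius : ℂ) * (z / torusRadius) = z
      field_simp
    exact ⟨(θ, φ), ⟨rfl, trivial⟩, by rw [angleTorusMap, hz2]⟩

theorem angleTorusMap_injective : Function.Injective angleTorusMap := by
  rintro ⟨θ, φ⟩ ⟨θ', φ'⟩ h
  have hr : (torusRadius : ℂ) ≠ 0 := Complex.ofReal_ne_zero.2 torusRadius_ne_zero
  obtain ⟨h1, h2⟩ := affinePt_inj.1 h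
  have hφ : φ = φ' := toCircle_injective (Circle.ext (mul_left_cancel₀ hr h1))
  subst hφ
  have hne : conj (torusRadius * φ.toCircle : ℂ) ≠ 0 :=
    (map_ne_zero _).2 (mul_ne_zero hr (Circle.coe_ne_zero _))
  exact congrArg (·, φ) (toCircle_injective (Circle.ext (mul_right_cancel₀ hne h2)))

theorem continuous_angleTorusMap : Continuous angleTorusMap := by
  have h1 : Continuous fun p : Real.Angle × Real.Angle => (p.1.toCircle : ℂ) :=
    continuous_subtype_val.comp (continuous_angle_toCircle.comp continuous_fst)
  have h2 : Continuous fun p : Real.Angle × Real.Angle => (torusRadius * p.2.toCircle : ℂ) :=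
    continuous_const.mul (continuous_subtype_val.comp (continuous_angle_toCircle.comp continuous_snd))
  exact continuous_affinePt.comp (h2.prodMk (h1.mul (Complex.continuous_conj.comp h2)))

/-- Two entries of the orthogonal projection onto a complex line, as a function of the line. -/
def projectorEntries : CP2 → ℂ × ℂ :=
  Projectivization.lift (fun v : {v : V // v ≠ 0} =>
    (v.1 0 * conj (v.1 2) / (∑ i, Complex.normSq (v.1 i) : ℝ),
      v.1 1 * conj (v.1 2) / (∑ i, Complex.normSq (v.1 i) : ℝ))) (by
    rintro ⟨v, hv⟩ ⟨w, hw⟩ t h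
    have ht : t ≠ 0 := by
      rintro rfl
      exact hv (by simpa using h)
    have ht' : conj t ≠ 0 := (map_ne_zero _).2 ht
    replace h : v = t • w := h
    subst h
    simp only [Pi.smul_apply, smul_eq_mul, map_mul, ← Finset.mul_sum,
      Complex.ofReal_mul, Complex.normSq_eq_conj_mul_self (z := t)]
    congr 1 <;>
    · rw [eq_comm, ← mul_div_mul_left _ _ (mul_ne_zero ht' ht)]
      ring)

theorem continuous_projectorEntries : Continuous projectorEntries := by
  refine continuous_coinduced_dom.2 ?_
  have hc : ∀ i, Continuous fun v : {v : V // v ≠ 0} => v.1 i := fun i =>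
    (continuous_apply i).comp continuous_subtype_val
  have hs : Continuous fun v : {v : V // v ≠ 0} => ((∑ i, Complex.normSq (v.1 i) : ℝ) : ℂ) :=
    Complex.continuous_ofReal.comp
      (continuous_finsetSum _ fun i _ => Complex.continuous_normSq.comp (hc i))
  have hs0 : ∀ v : {v : V // v ≠ 0}, ((∑ i, Complex.normSq (v.1 i) : ℝ) : ℂ) ≠ 0 := by
    rintro ⟨v, hv⟩ h
    rw [Complex.ofReal_eq_zero,
      Finset.sum_eq_zero_iff_of_nonneg fun i _ => Complex.normSq_nonneg _] at h
    exact hv (funext fun i => Complex.normSq_eq_zero.1 (h i (Finset.mem_univ i)))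
  exact (((hc 0).mul (Complex.continuous_conj.comp (hc 2))).div hs hs0).prodMk
    (((hc 1).mul (Complex.continuous_conj.comp (hc 2))).div hs hs0)

theorem projectorEntries_affinePt (z w : ℂ) : projectorEntries (affinePt z w) =
    (z / (Complex.normSq z + Complex.normSq w + 1 : ℝ),
      w / (Complex.normSq z + Complex.normSq w + 1 : ℝ)) := by
  rw [affinePt, projectorEntries, Projectivization.lift_mk]
  simp [Fin.sum_univ_three]

/-- On the torus `|z|² + |w|² + 1 = 2`, so the two entries are `z / 2` and `w / 2`, and doubling
them recovers the point. -/
theorem projectorEntries_angleTorusMap (p : Real.Angle × Real.Angle) :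
    angleTorusMap p = affinePt (2 * (projectorEntries (angleTorusMap p)).1)
      (2 * (projectorEntries (angleTorusMap p)).2) := by
  have h : Complex.normSq (torusRadius * p.2.toCircle : ℂ) = 1 / 2 := by
    rw [Complex.normSq_mul, Circle.normSq_coe, Complex.normSq_ofReal, torusRadius_mul_self, mul_one]
  rw [angleTorusMap, projectorEntries_affinePt, normSq_circle_mul_conj, h, affinePt_inj]
  constructor
  · push_cast
    ring
  · push_cast
    ring

/-- Composed with `projectorEntries`, the map is a continuous injection of a compact space into the
Hausdorff space `ℂ × ℂ`, hence an embedding; the first factor of an embedding into which both maps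
are continuous is itself an embedding. -/
theorem isEmbedding_angleTorusMap : Topology.IsEmbedding angleTorusMap := by
  refine Topology.IsEmbedding.of_comp continuous_angleTorusMap continuous_projectorEntries
    ((continuous_projectorEntries.comp continuous_angleTorusMap).isClosedEmbedding
      fun p q h => angleTorusMap_injective ?_).isEmbedding
  rw [projectorEntries_angleTorusMap p, projectorEntries_angleTorusMap q]
  exact congrArg (fun x : ℂ × ℂ => affinePt (2 * x.1) (2 * x.2)) h

end ComplexHyperbolic

end

/-! ### Transport from the diagonal model to a general isometry -/

open scoped Pointwise in
theorem mainTheorem6 (f : ComplexHyperbolic.PU21)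
    (hreg : ComplexHyperbolic.IsRegularElliptic f)
    (hreal : ComplexHyperbolic.IsRealElliptic f) :
    ∃ p : ComplexHyperbolic.CP2,
      -- `p` is the fixed point of `f` in the complex hyperbolic plane
      (∀ q : ComplexHyperbolic.CP2,
        (q ∈ ComplexHyperbolic.hyperbolicPlane ∧ f • q = q) ↔ q = p) ∧
      ∃ L : Real.Angle → Set ComplexHyperbolic.CP2,
        -- the family is parameterised, without repetition, by an angle
        Function.Injective L ∧
        Set.range L = ComplexHyperbolic.preservedPlanes f p ∧
        -- the ideal boundaries are pairwise disjoint `ℝ`-circles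
        (∀ θ, ComplexHyperbolic.IsRCircle (ComplexHyperbolic.idealBoundary (L θ))) ∧
        (∀ θ θ', θ ≠ θ' → Disjoint (ComplexHyperbolic.idealBoundary (L θ))
          (ComplexHyperbolic.idealBoundary (L θ'))) ∧
        -- their union is an embedded torus in the boundary, of which they are the leaves
        (⋃ θ, ComplexHyperbolic.idealBoundary (L θ)) ⊆ ComplexHyperbolic.boundary ∧
        ∃ Φ : Real.Angle × Real.Angle → ComplexHyperbolic.CP2,
          Topology.IsEmbedding Φ ∧
          Set.range Φ = (⋃ θ, ComplexHyperbolic.idealBoundary (L θ)) ∧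
          ∀ θ, Φ '' ({θ} ×ˢ Set.univ) = ComplexHyperbolic.idealBoundary (L θ) := by
  open ComplexHyperbolic in
  obtain ⟨θ, hθ⟩ := hreal
  have hsin := sin_ne_zero_of_isRegularElliptic hreg hθ
  obtain ⟨g, hg⟩ := isConj_iff.1 hθ.symm
  have hemb : Topology.IsEmbedding fun x : CP2 => g • x := (Homeomorph.smul g).isEmbedding
  have himage : ∀ θ, (fun p => g • angleTorusMap p) '' ({θ} ×ˢ Set.univ) =
      idealBoundary (g • modelPlane θ.toCircle) := by
    intro θ
    rw [idealBoundary_smul, ← image_angleTorusMap, ← Set.image_smul, Set.image_image]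
  refine ⟨g • affinePt 0 0, fun q => ?_, fun θ => g • modelPlane θ.toCircle, ?_, ?_, ?_, ?_, ?_,
    fun p => g • angleTorusMap p, hemb.comp isEmbedding_angleTorusMap, ?_, himage⟩
  · rw [← inv_smul_eq_iff, ← fixed_iff_of_sin_ne_zero hsin, smul_mem_hyperbolicPlane, ← hg,
      mul_smul, mul_smul, smul_eq_iff_eq_inv_smul]
  · exact (MulAction.injective g).comp (modelPlane_injective.comp toCircle_injective)
  · rw [← hg, preservedPlanes_conj, preservedPlanes_diagRotation hsin,
      ← toCircle_surjective.range_comp, ← Set.range_comp]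
    rfl
  · exact fun θ => ⟨_, (isLagrangianPlane_modelPlane _).smul g, rfl⟩
  · intro θ θ' hne
    rw [idealBoundary_smul, idealBoundary_smul, Set.disjoint_smul_set]
    exact disjoint_idealBoundary_modelPlane (toCircle_injective.ne hne)
  · exact Set.iUnion_subset fun θ => Set.inter_subset_right
  · simp_rw [← himage, ← Set.image_iUnion, ← Set.iUnion_prod_const, Set.iUnion_of_singleton,
      Set.univ_prod_univ, Set.image_univ]
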